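/- Let $G$ be a transitive permutation group on a finite set $\Omega$ of size $n\ge 2$, and let $G_x$ be the stabiliser in $G$ of a point $x\in\Omega$. For a finite group $H$, let $\mathrm{Comp}_A(H)$ denote the set of isomorphism types of abelian composition factors of $H$ (equivalently, of composition factors of $H$ that are cyclic of prime order). Then $$\bigl|\mathrm{Comp}_A(G_x)\bigr| < 2(\log_2 n)^2 .$$ -/

import Mathlib

/-- `H` is a normal subgroup of `K` (both being subgroups of `G`) and `K / H` is a simple group. -/
def IsCompositionStep {G : Type*} [Group G] (H K : Subgroup G) : Prop :=
  H ≤ K ∧ ∃ _ : (H.subgroupOf K).Normal, IsSimpleGroup (↥K ⧸ H.subgroupOf K)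

/-- A composition series `1 = H₀ ◁ H₁ ◁ ⋯ ◁ H_l = G` of a group `G`: a finite chain of subgroups
from the trivial subgroup to `G`, each normal in the next one, with simple quotients. -/
structure GroupCompositionSeries (G : Type*) [Group G] where
  /-- the chain of subgroups, in increasing order -/
  series : RelSeries {p : Subgroup G × Subgroup G | IsCompositionStep p.1 p.2}
  head_eq_bot : series.head = ⊥
  last_eq_top : series.last = ⊤

/-- The group `Q` is (isomorphic to) a composition factor of `G`, that is, to a quotient
`Hᵢ₊₁ / Hᵢ` of consecutive terms of a composition series of `G`. -/
def IsCompositionFactor (G Q : Type*) [Group G] [Group Q] : Prop :=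
  ∃ (s : GroupCompositionSeries G) (i : Fin s.series.length)
    (_ : ((s.series i.castSucc).subgroupOf (s.series i.succ)).Normal),
    Nonempty (Q ≃* ↥(s.series i.succ) ⧸ (s.series i.castSucc).subgroupOf (s.series i.succ))

/-- Isomorphism types of groups (in a fixed universe). -/
abbrev GroupIsoType.{u} : Type (u + 1) :=
  Quotient (CategoryTheory.isIsomorphicSetoid GrpCat.{u})

/-- `CompA G` is the set of isomorphism types of abelian composition factors of `G`. -/
def CompA.{u} (G : Type u) [Group G] : Set GroupIsoType.{u} :=
  {c | ∃ Q : GrpCat.{u}, c = Quotient.mk _ Q ∧ IsCompositionFactor G Q ∧ ∀ a b : Q, a * b = b * a}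

/-! For a prime `p`, let the residual of a group be its smallest normal subgroup whose quotient has
no composition factor of order `p`. If the residuals of `G` and `G_x` agree, the common subgroup is
normal in `G` and lies in the core-free group `G_x`, so it is trivial and `G_x` has no factor of
order `p` (`compA_subset_image`). It therefore suffices to bound, for any `H ≤ A` of index `n ≥ 2`,
the number of primes at which the residuals differ. This is `ncard_residualPrimes_lt`, by strong
induction on `n`.

An intermediate subgroup splits the problem, since `log²` is superadditive over products of indices.
So let `H` be maximal in `A`, with core `K`, and write `L = log₂ n`.

If no `u ∈ A \ H` has `u² ∈ H`, then the `H`-orbits of `gH` and `g⁻¹H` are distinct, so `H ∩ gHg⁻¹`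
has index below `n/2` in `H`. Primes of elements of `A` outside `H` divide `n` or persist for this
smaller pair, and `L + (L - 1)² ≤ L²` closes an induction (`ncard_elementPrimes_le`).

Otherwise take `z ∈ A \ H` with `z² ∈ H`, and `N/K` minimal normal in `A/K`. If `N/K` is abelian, it
has order `n` and `H/K` acts faithfully on it, which bounds `|A/K|` and hence its number of prime
divisors (`ncard_elementPrimes_lt_of_abelian`). If not, `N/K` has no factors of prime order. As `z`
normalizes `H ∩ zHz⁻¹`, every prime for `(A, H)` is already one for `(H, H ∩ zHz⁻¹)`, a pair of
smaller index. -/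

section

/-! ### Normality and subnormality inside an ambient group -/

variable {Γ : Type*} [Group Γ]

/-- `K` is contained in `A` and normalized by `A`. -/
def NormalIn (K A : Subgroup Γ) : Prop :=
  K ≤ A ∧ ∀ a ∈ A, ∀ k ∈ K, a * k * a⁻¹ ∈ K

/-- `S` is a subnormal subgroup of `A`. -/
def SubnormalIn : Subgroup Γ → Subgroup Γ → Prop :=
  Relation.ReflTransGen NormalIn

theorem Subgroup.mem_sup_of_conj_mem {S N : Subgroup Γ}
    (h : ∀ a ∈ S, ∀ k ∈ N, a * k * a⁻¹ ∈ N) {x : Γ} :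
    x ∈ S ⊔ N ↔ ∃ s ∈ S, ∃ k ∈ N, x = s * k := by
  have hle : S ≤ Subgroup.normalizer (N : Set Γ) := by
    intro s hs
    rw [Subgroup.mem_normalizer_iff]
    intro k
    refine ⟨fun hk => h s hs k hk, fun hk => ?_⟩
    have := h s⁻¹ (S.inv_mem hs) _ hk
    simpa [mul_assoc] using this
  rw [← SetLike.mem_coe, Subgroup.coe_mul_of_left_le_normalizer_right S N hle, Set.mem_mul]
  constructor
  · rintro ⟨s, hs, k, hk, rfl⟩
    exact ⟨s, hs, k, hk, rfl⟩
  · rintro ⟨s, hs, k, hk, rfl⟩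
    exact ⟨s, hs, k, hk, rfl⟩

namespace NormalIn

variable {K A B N S T : Subgroup Γ}

theorem refl (A : Subgroup Γ) : NormalIn A A :=
  ⟨le_rfl, fun _ ha _ hk => A.mul_mem (A.mul_mem ha hk) (A.inv_mem ha)⟩

theorem mono_right (h : NormalIn K A) (hKB : K ≤ B) (hBA : B ≤ A) : NormalIn K B :=
  ⟨hKB, fun a ha => h.2 a (hBA ha)⟩

theorem inf (h : NormalIn K A) (hB : NormalIn B A) : NormalIn (K ⊓ B) A :=
  ⟨inf_le_left.trans h.1, fun a ha k hk => ⟨h.2 a ha k hk.1, hB.2 a ha k hk.2⟩⟩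

theorem inf_right (h : NormalIn K A) (B : Subgroup Γ) : NormalIn (K ⊓ B) (A ⊓ B) :=
  ⟨inf_le_inf_right B h.1, fun a ha k hk => ⟨h.2 a ha.1 k hk.1,
    B.mul_mem (B.mul_mem ha.2 hk.2) (B.inv_mem ha.2)⟩⟩

theorem sup_of_conj_mem (h : NormalIn T S) (hN : ∀ a ∈ S, ∀ k ∈ N, a * k * a⁻¹ ∈ N) :
    NormalIn (T ⊔ N) (S ⊔ N) := by
  have hN' : ∀ a ∈ T, ∀ k ∈ N, a * k * a⁻¹ ∈ N := fun a ha => hN a (h.1 ha)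
  refine ⟨sup_le_sup_right h.1 N, fun a ha k hk => ?_⟩
  obtain ⟨s, hs, u, hu, rfl⟩ := (Subgroup.mem_sup_of_conj_mem hN).1 ha
  have hu' : u ∈ T ⊔ N := (le_sup_right : N ≤ T ⊔ N) hu
  have h1 : u * k * u⁻¹ ∈ T ⊔ N := mul_mem (mul_mem hu' hk) (inv_mem hu')
  obtain ⟨t, ht, v, hv, e⟩ := (Subgroup.mem_sup_of_conj_mem hN').1 h1
  refine (Subgroup.mem_sup_of_conj_mem hN').2
    ⟨s * t * s⁻¹, h.2 s hs t ht, s * v * s⁻¹, hN s hs v hv, ?_⟩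
  have : s * u * k * (s * u)⁻¹ = s * (u * k * u⁻¹) * s⁻¹ := by group
  rw [this, e]
  group

theorem sup (h : NormalIn T A) (hN : NormalIn N A) : NormalIn (T ⊔ N) A := by
  have := h.sup_of_conj_mem hN.2
  rwa [sup_eq_left.2 hN.1] at this

theorem map (h : NormalIn K A) (e : Γ ≃* Γ) :
    NormalIn (K.map e.toMonoidHom) (A.map e.toMonoidHom) := by
  refine ⟨Subgroup.map_mono h.1, ?_⟩
  rintro _ ⟨a, ha, rfl⟩ _ ⟨k, hk, rfl⟩
  exact ⟨a * k * a⁻¹, h.2 a ha k hk, by simp⟩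

end NormalIn

namespace SubnormalIn

variable {K A B N S T : Subgroup Γ}

theorem refl (A : Subgroup Γ) : SubnormalIn A A := Relation.ReflTransGen.refl

theorem trans (h : SubnormalIn S T) (h' : SubnormalIn T A) : SubnormalIn S A :=
  Relation.ReflTransGen.trans h h'

theorem _root_.NormalIn.subnormalIn (h : NormalIn K A) : SubnormalIn K A :=
  Relation.ReflTransGen.single h

theorem le (h : SubnormalIn S A) : S ≤ A := by
  induction h with
  | refl => exact le_rfl
  | tail _ h ih => exact ih.trans h.1

theorem inf_right (h : SubnormalIn S A) (B : Subgroup Γ) : SubnormalIn (S ⊓ B) (A ⊓ B) := by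
  induction h with
  | refl => exact refl _
  | tail _ h ih => exact ih.trans (h.inf_right B).subnormalIn

theorem sup (h : SubnormalIn S A) (hN : NormalIn N A) : SubnormalIn (S ⊔ N) A := by
  have key : ∀ C, SubnormalIn C A → SubnormalIn (C ⊔ N) A := by
    intro C hC
    induction hC using Relation.ReflTransGen.head_induction_on with
    | refl => rw [sup_eq_left.2 hN.1]; exact refl A
    | head h1 h2 ih =>
      exact (h1.sup_of_conj_mem fun a ha => hN.2 a (SubnormalIn.le h2 ha)).subnormalIn.trans ih
  exact key S h

theorem map (h : SubnormalIn S A) (e : Γ ≃* Γ) :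
    SubnormalIn (S.map e.toMonoidHom) (A.map e.toMonoidHom) := by
  induction h with
  | refl => exact refl _
  | tail _ h ih => exact ih.trans (h.map e).subnormalIn

end SubnormalIn

/-! ### Relative indices and sections of order `p` -/

theorem Subgroup.relIndex_eq_of_forall_eq_mul {U S V : Subgroup Γ} (hSV : S ≤ V)
    (h : ∀ v ∈ V, ∃ s ∈ S, ∃ u ∈ U, v = s * u) : U.relIndex V = U.relIndex S := by
  symm
  refine Nat.card_congr (Equiv.ofBijective (Subgroup.quotientSubgroupOfEmbeddingOfLE U hSV)
    ⟨(Subgroup.quotientSubgroupOfEmbeddingOfLE U hSV).injective, fun q => ?_⟩)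
  induction q using QuotientGroup.induction_on with
  | H v =>
    obtain ⟨s, hs, u, hu, e⟩ := h v v.2
    refine ⟨QuotientGroup.mk ⟨s, hs⟩, ?_⟩
    rw [Subgroup.quotientSubgroupOfEmbeddingOfLE_apply_mk, QuotientGroup.eq,
      Subgroup.mem_subgroupOf]
    simpa [e] using hu

theorem Subgroup.eq_or_eq_of_relIndex_prime {T U S : Subgroup Γ} {p : ℕ} (hp : p.Prime)
    (hTU : T ≤ U) (hUS : U ≤ S) (h : T.relIndex S = p) : U = T ∨ U = S := by
  rw [← Subgroup.relIndex_mul_relIndex T U S hTU hUS] at h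
  rcases (Nat.prime_mul_iff.1 (h ▸ hp)) with ⟨_, h1⟩ | ⟨_, h1⟩
  · exact Or.inr (le_antisymm hUS (Subgroup.relIndex_eq_one.1 h1))
  · exact Or.inl (le_antisymm (Subgroup.relIndex_eq_one.1 h1) hTU)

/-- Passing to the images in the quotient by `N` does not change the index if `S ∩ N ≤ T`. -/
theorem Subgroup.relIndex_sup_sup {T S N : Subgroup Γ} (hTS : T ≤ S)
    (hN : ∀ a ∈ S, ∀ k ∈ N, a * k * a⁻¹ ∈ N) (h : S ⊓ N ≤ T) :
    (T ⊔ N).relIndex (S ⊔ N) = T.relIndex S := by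
  rw [Subgroup.relIndex_eq_of_forall_eq_mul (le_sup_left : S ≤ S ⊔ N),
    ← Subgroup.inf_relIndex_right]
  · congr 1
    apply le_antisymm
    · rintro x ⟨hx, hxS⟩
      obtain ⟨t, ht, k, hk, rfl⟩ :=
        (Subgroup.mem_sup_of_conj_mem fun a ha => hN a (hTS ha)).1 hx
      exact T.mul_mem ht (h ⟨(Subgroup.mul_mem_cancel_left S (hTS ht)).1 hxS, hk⟩)
    · exact le_inf le_sup_left hTS
  · intro v hv
    obtain ⟨s, hs, k, hk, rfl⟩ := (Subgroup.mem_sup_of_conj_mem hN).1 hv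
    exact ⟨s, hs, k, (le_sup_right : N ≤ T ⊔ N) hk, rfl⟩

/-- No section `S / T` of `A` with `K ≤ T ⊲ S` and `S` subnormal in `A` has order `p`. If `K` is
normal in `A`, this says that `A / K` has no composition factor of order `p`. -/
def NoFactor (p : ℕ) (K A : Subgroup Γ) : Prop :=
  ∀ S T, K ≤ T → SubnormalIn S A → NormalIn T S → T.relIndex S ≠ p

namespace NoFactor

variable {p : ℕ} {K K' A N S : Subgroup Γ}

theorem of_subnormalIn (h : NoFactor p K A) (hS : SubnormalIn S A) : NoFactor p K S :=
  fun S' T hT hS' => h S' T hT (hS'.trans hS)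

theorem mono_left (h : NoFactor p K A) (hK : K ≤ K') : NoFactor p K' A :=
  fun S T hT => h S T (hK.trans hT)

theorem self (hp : p.Prime) (A : Subgroup Γ) : NoFactor p A A := by
  intro S T hT hS _ h
  rw [Subgroup.relIndex_eq_one.2 (hS.le.trans hT)] at h
  exact hp.one_lt.ne h

/-- A section `S / T` of order `p` above `K` survives in `A / N` if `S ∩ N ≤ T`. Otherwise primality
of the index forces `S = (S ∩ N) T`, and the section already occurs inside `N`. -/
theorem trans (hp : p.Prime) (hKN : NoFactor p K N) (hNA : NoFactor p N A) (hN : NormalIn N A)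
    (hK : K ≤ N) : NoFactor p K A := by
  intro S T hT hS hTS hind
  have hSN : ∀ a ∈ S, ∀ k ∈ N, a * k * a⁻¹ ∈ N := fun a ha => hN.2 a (hS.le ha)
  by_cases hle : S ⊓ N ≤ T
  · refine hNA (S ⊔ N) (T ⊔ N) le_sup_right (hS.sup hN) (hTS.sup_of_conj_mem hSN) ?_
    rw [Subgroup.relIndex_sup_sup hTS.1 hSN hle, hind]
  · have hTN : ∀ a ∈ S ⊓ N, ∀ k ∈ T, a * k * a⁻¹ ∈ T := fun a ha => hTS.2 a ha.1
    have hsup : S ⊓ N ⊔ T = S := by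
      refine (Subgroup.eq_or_eq_of_relIndex_prime hp le_sup_right
        (sup_le inf_le_left hTS.1) hind).resolve_left fun e => hle ?_
      rw [← e]; exact le_sup_left
    refine hKN (S ⊓ N) (T ⊓ N) (le_inf hT hK) ?_ (hTS.inf_right N) ?_
    · have := hS.inf_right N
      rwa [inf_eq_right.2 hN.1] at this
    · rw [← hind, Subgroup.relIndex_eq_of_forall_eq_mul (inf_le_left : S ⊓ N ≤ S)]
      · rw [← Subgroup.inf_relIndex_right T (S ⊓ N), ← inf_assoc, inf_eq_left.2 hTS.1]
      · intro v hv
        rw [← hsup] at hv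
        exact (Subgroup.mem_sup_of_conj_mem hTN).1 hv

/-- Below `K`, a section `S / T` with `K ∩ N ≤ T` has `S ∩ N ≤ T`, so it keeps its order in `A / N`.
-/
theorem inf (hp : p.Prime) (hK : NormalIn K A) (hN : NormalIn N A) (hKA : NoFactor p K A)
    (hNA : NoFactor p N A) : NoFactor p (K ⊓ N) A := by
  refine trans hp (N := K) ?_ hKA hK inf_le_left
  intro S T hT hS hTS hind
  have hSA : SubnormalIn S A := hS.trans hK.subnormalIn
  have hSN : ∀ a ∈ S, ∀ k ∈ N, a * k * a⁻¹ ∈ N := fun a ha => hN.2 a (hSA.le ha)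
  refine hNA (S ⊔ N) (T ⊔ N) le_sup_right (hSA.sup hN) (hTS.sup_of_conj_mem hSN) ?_
  rw [Subgroup.relIndex_sup_sup hTS.1 hSN ((inf_le_inf_right N hS.le).trans hT), hind]

theorem map (h : NoFactor p K A) (e : Γ ≃* Γ) :
    NoFactor p (K.map e.toMonoidHom) (A.map e.toMonoidHom) := by
  have hinv : ∀ B : Subgroup Γ, (B.map e.toMonoidHom).map e.symm.toMonoidHom = B := by
    intro B
    ext x
    simp [Subgroup.mem_map]
  intro S T hT hS hTS hind
  have h1 := Subgroup.map_mono (f := e.symm.toMonoidHom) hT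
  have h2 := hS.map e.symm
  rw [hinv] at h1 h2
  refine h _ _ h1 h2 (hTS.map e.symm) ?_
  rw [Subgroup.relIndex_map_map_of_injective _ _ e.symm.injective, hind]

end NoFactor

/-! ### The residual of a subgroup at a prime -/

/-- The smallest normal subgroup of `A` whose quotient has no composition factor of order `p`. -/
def factorResidual (p : ℕ) (A : Subgroup Γ) : Subgroup Γ :=
  sInf {K | NormalIn K A ∧ NoFactor p K A}

section Residual

variable {p : ℕ} {K A : Subgroup Γ}

theorem factorResidual_le_of (hK : NormalIn K A) (h : NoFactor p K A) : factorResidual p A ≤ K :=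
  sInf_le ⟨hK, h⟩

theorem factorResidual_spec [Finite Γ] (hp : p.Prime) (A : Subgroup Γ) :
    NormalIn (factorResidual p A) A ∧ NoFactor p (factorResidual p A) A := by
  have hfin : {K : Subgroup Γ | NormalIn K A ∧ NoFactor p K A}.Finite := Set.toFinite _
  -- Meeting with `A` makes the empty family harmless, its infimum being `⊤`.
  have key : ∀ s : Set (Subgroup Γ), s.Finite →
      (∀ K ∈ s, NormalIn K A ∧ NoFactor p K A) →
      NormalIn (A ⊓ sInf s) A ∧ NoFactor p (A ⊓ sInf s) A := by
    intro s hs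
    induction s, hs using Set.Finite.induction_on with
    | empty => intro _; simpa using ⟨NormalIn.refl A, NoFactor.self hp A⟩
    | insert _ _ ih =>
      intro h
      have h1 := h _ (Set.mem_insert _ _)
      have h2 := ih fun K hK => h K (Set.mem_insert_of_mem _ hK)
      rw [sInf_insert, inf_left_comm]
      exact ⟨h1.1.inf h2.1, NoFactor.inf hp h1.1 h2.1 h1.2 h2.2⟩
  have := key _ hfin fun K hK => hK
  rwa [inf_eq_right.2] at this
  exact sInf_le ⟨NormalIn.refl A, NoFactor.self hp A⟩

theorem factorResidual_le [Finite Γ] (hp : p.Prime) (A : Subgroup Γ) : factorResidual p A ≤ A :=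
  (factorResidual_spec hp A).1.1

theorem factorResidual_map (e : Γ ≃* Γ) (A : Subgroup Γ) :
    factorResidual p (A.map e.toMonoidHom) = (factorResidual p A).map e.toMonoidHom := by
  have hinv : ∀ B : Subgroup Γ, (B.map e.toMonoidHom).map e.symm.toMonoidHom = B := by
    intro B
    ext x
    simp [Subgroup.mem_map]
  have hinv' : ∀ B : Subgroup Γ, (B.map e.symm.toMonoidHom).map e.toMonoidHom = B := by
    intro B
    ext x
    simp [Subgroup.mem_map]
  apply le_antisymm
  · rw [← hinv' (factorResidual p (A.map e.toMonoidHom))]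
    refine Subgroup.map_mono (le_sInf ?_)
    rintro K ⟨hK, h⟩
    rw [← hinv K]
    exact Subgroup.map_mono (factorResidual_le_of (hK.map e) (h.map e))
  · refine le_sInf ?_
    rintro K ⟨hK, h⟩
    rw [← hinv' K]
    refine Subgroup.map_mono (factorResidual_le_of ?_ ?_)
    · have := hK.map e.symm
      rwa [hinv] at this
    · have := h.map e.symm
      rwa [hinv] at this

/-- The element `g` need only normalize `A`, not lie in it; this is what allows conjugation by `z`
later. -/
theorem conj_mem_factorResidual {g : Γ} (hg : ∀ a, a ∈ A ↔ g * a * g⁻¹ ∈ A) {x : Γ}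
    (hx : x ∈ factorResidual p A) : g * x * g⁻¹ ∈ factorResidual p A := by
  have hA : A.map (MulAut.conj g).toMonoidHom = A := by
    ext a
    constructor
    · rintro ⟨b, hb, rfl⟩
      exact (hg b).1 hb
    · intro ha
      refine ⟨g⁻¹ * a * g, (hg _).2 (by simpa [mul_assoc] using ha), ?_⟩
      simp [mul_assoc]
  have := factorResidual_map (p := p) (MulAut.conj g) A
  rw [hA] at this
  rw [this]
  exact ⟨x, hx, by simp⟩

/-- The residual of `K` is invariant under `A` and has no factor of order `p` above it in `A`, by
`NoFactor.trans`. Conversely the residual of `A` lies in `K`, and absence of factors passes to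
subnormal subgroups. -/
theorem factorResidual_eq_of_normalIn [Finite Γ] (hp : p.Prime) (hK : NormalIn K A)
    (h : NoFactor p K A) : factorResidual p A = factorResidual p K := by
  have hA := factorResidual_spec hp A
  have hR := factorResidual_spec hp K
  have hle : factorResidual p A ≤ K := factorResidual_le_of hK h
  apply le_antisymm
  · refine factorResidual_le_of ⟨hR.1.1.trans hK.1, fun a ha k hk => ?_⟩
      (NoFactor.trans hp hR.2 h hK hR.1.1)
    refine conj_mem_factorResidual (fun b => ⟨hK.2 a ha b, fun hb => ?_⟩) hk
    have := hK.2 a⁻¹ (A.inv_mem ha) _ hb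
    simpa [mul_assoc] using this
  · exact factorResidual_le_of (hA.1.mono_right hle hK.1) (hA.2.of_subnormalIn hK.subnormalIn)

theorem factorResidual_factorResidual [Finite Γ] (hp : p.Prime) (A : Subgroup Γ) :
    factorResidual p (factorResidual p A) = factorResidual p A :=
  (factorResidual_eq_of_normalIn hp (factorResidual_spec hp A).1 (factorResidual_spec hp A).2).symm

end Residual

/-! ### The primes attached to a pair of subgroups -/

/-- The primes `p` for which `A` has an element of `p`-power order outside `H`. -/
def elementPrimes (A H : Subgroup Γ) : Set ℕ :=
  {p | p.Prime ∧ ∃ g ∈ A, g ∉ H ∧ ∃ k : ℕ, g ^ p ^ k = 1}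

/-- The primes `p` for which `A` and `H` have different residuals. -/
def residualPrimes (A H : Subgroup Γ) : Set ℕ :=
  {p | p.Prime ∧ factorResidual p A ≠ factorResidual p H}

theorem Subgroup.relIndex_ne_zero_of_finite [Finite Γ] (H A : Subgroup Γ) : H.relIndex A ≠ 0 :=
  Subgroup.index_ne_zero_of_finite

theorem mem_of_pow_mem_of_coprime {H : Subgroup Γ} {g : Γ} {m n : ℕ} (hmn : m.Coprime n)
    (hm : g ^ m ∈ H) (hn : g ^ n ∈ H) : g ∈ H := by
  have h := Nat.gcd_eq_gcd_ab m n
  rw [hmn.gcd_eq_one] at h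
  have : g = (g ^ m) ^ (m.gcdA n) * (g ^ n) ^ (m.gcdB n) := by
    rw [← zpow_natCast, ← zpow_natCast, ← zpow_mul, ← zpow_mul, ← zpow_add, ← h]
    simp
  rw [this]
  exact H.mul_mem (H.zpow_mem hm _) (H.zpow_mem hn _)

theorem elementPrimes_subset_of_normalIn [Finite Γ] {A H K : Subgroup Γ} (hK : NormalIn K A)
    (hKH : K ≤ H) : elementPrimes A H ⊆ (K.relIndex A).primeFactors := by
  rintro p ⟨hp, g, hgA, hgH, k, hk⟩
  have hne : K.relIndex A ≠ 0 := Subgroup.relIndex_ne_zero_of_finite K A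
  rw [Finset.mem_coe, Nat.mem_primeFactors]
  refine ⟨hp, ?_, hne⟩
  by_contra hdvd
  have hn : (K.subgroupOf A).Normal := by
    refine ⟨fun n hn a => ?_⟩
    rw [Subgroup.mem_subgroupOf] at hn ⊢
    exact hK.2 a a.2 n hn
  have h1 := Subgroup.pow_index_mem (K.subgroupOf A) ⟨g, hgA⟩
  rw [Subgroup.mem_subgroupOf] at h1
  refine hgH (hKH (mem_of_pow_mem_of_coprime
    (((Nat.Prime.coprime_iff_not_dvd hp).2 hdvd).pow_left k) ?_ h1))
  rw [hk]
  exact K.one_mem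

theorem elementPrimes_finite [Finite Γ] (A H : Subgroup Γ) : (elementPrimes A H).Finite := by
  refine (Finset.finite_toSet ((⊥ : Subgroup Γ).relIndex A).primeFactors).subset
    (elementPrimes_subset_of_normalIn ⟨bot_le, ?_⟩ bot_le)
  intro a _ k hk
  rw [Subgroup.mem_bot] at hk ⊢
  simp [hk]

theorem elementPrimes_subset_union (A M H : Subgroup Γ) :
    elementPrimes A H ⊆ elementPrimes A M ∪ elementPrimes M H := by
  rintro p ⟨hp, g, hgA, hgH, hg⟩
  by_cases h : g ∈ M
  · exact Or.inr ⟨hp, g, h, hgH, hg⟩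
  · exact Or.inl ⟨hp, g, hgA, h, hg⟩

theorem residualPrimes_subset_union (A M H : Subgroup Γ) :
    residualPrimes A H ⊆ residualPrimes A M ∪ residualPrimes M H := by
  rintro p ⟨hp, h⟩
  by_cases h' : factorResidual p A = factorResidual p M
  · exact Or.inr ⟨hp, h' ▸ h⟩
  · exact Or.inl ⟨hp, h'⟩

/-- The subgroup generated by the elements of `p`-power order. -/
def pElementsClosure (p : ℕ) (A : Subgroup Γ) : Subgroup Γ :=
  Subgroup.closure {g | g ∈ A ∧ ∃ k : ℕ, g ^ p ^ k = 1}

theorem pElementsClosure_normalIn (p : ℕ) (A : Subgroup Γ) :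
    NormalIn (pElementsClosure p A) A := by
  refine ⟨(Subgroup.closure_le _).2 fun g hg => hg.1, fun a ha k hk => ?_⟩
  have h : pElementsClosure p A ≤ (pElementsClosure p A).comap (MulAut.conj a).toMonoidHom := by
    refine (Subgroup.closure_le _).2 fun g hg => ?_
    refine Subgroup.subset_closure ⟨?_, ?_⟩
    · simpa using A.mul_mem (A.mul_mem ha hg.1) (A.inv_mem ha)
    · obtain ⟨n, hn⟩ := hg.2
      refine ⟨n, ?_⟩
      rw [← map_pow, hn, map_one]
  simpa using h hk

/-- If `T` has index `p` in `S` and `s ∈ S` has order `p ^ k * m` with `p ∤ m`, then `s ^ m` is a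
`p`-element, hence in `T`, and so is `s ^ p`; coprimality gives `s ∈ T`. -/
theorem noFactor_pElementsClosure [Finite Γ] {p : ℕ} (hp : p.Prime) (A : Subgroup Γ) :
    NoFactor p (pElementsClosure p A) A := by
  intro S T hT hS hTS hind
  have hnle : ¬ S ≤ T := by
    intro h
    rw [Subgroup.relIndex_eq_one.2 h] at hind
    exact hp.one_lt.ne hind
  obtain ⟨s, hs, hsT⟩ := SetLike.not_le_iff_exists.1 hnle
  obtain ⟨k, m, hm, hord⟩ := Nat.exists_eq_pow_mul_and_not_dvd
    (orderOf_pos s).ne' p hp.ne_one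
  have h1 : s ^ m ∈ T := by
    refine hT (Subgroup.subset_closure ⟨A.pow_mem (hS.le hs) m, k, ?_⟩)
    rw [← pow_mul, mul_comm, ← hord, pow_orderOf_eq_one]
  have hn : (T.subgroupOf S).Normal := by
    refine ⟨fun n hn a => ?_⟩
    rw [Subgroup.mem_subgroupOf] at hn ⊢
    exact hTS.2 a a.2 n hn
  have h2 := Subgroup.pow_index_mem (T.subgroupOf S) ⟨s, hs⟩
  rw [Subgroup.mem_subgroupOf] at h2
  have h2 : s ^ p ∈ T := by rw [← hind]; exact h2
  exact hsT (mem_of_pow_mem_of_coprime ((Nat.Prime.coprime_iff_not_dvd hp).2 hm) h2 h1)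

/-- The residual depends only on the subgroup generated by the `p`-elements, which is the same for
`A` and `H` if `H` contains every `p`-element of `A`. -/
theorem residualPrimes_subset_elementPrimes [Finite Γ] {A H : Subgroup Γ} (hHA : H ≤ A) :
    residualPrimes A H ⊆ elementPrimes A H := by
  rintro p ⟨hp, h⟩
  by_contra hcon
  refine h ?_
  have hEH : pElementsClosure p A = pElementsClosure p H := by
    unfold pElementsClosure
    congr 1
    ext g
    refine ⟨fun hg => ⟨?_, hg.2⟩, fun hg => ⟨hHA hg.1, hg.2⟩⟩
    by_contra hgH
    exact hcon ⟨hp, g, hg.1, hgH, hg.2⟩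
  rw [factorResidual_eq_of_normalIn hp (pElementsClosure_normalIn p A)
      (noFactor_pElementsClosure hp A), hEH,
    factorResidual_eq_of_normalIn hp (pElementsClosure_normalIn p H)
      (noFactor_pElementsClosure hp H)]

theorem residualPrimes_finite [Finite Γ] {A H : Subgroup Γ} (hHA : H ≤ A) :
    (residualPrimes A H).Finite :=
  (elementPrimes_finite A H).subset (residualPrimes_subset_elementPrimes hHA)

/-! ### Conjugates and maximal subgroups -/

/-- The conjugate `g H g⁻¹`. -/
def conjSubgroup (g : Γ) (H : Subgroup Γ) : Subgroup Γ :=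
  H.map (MulAut.conj g).toMonoidHom

theorem mem_conjSubgroup {g x : Γ} {H : Subgroup Γ} :
    x ∈ conjSubgroup g H ↔ g⁻¹ * x * g ∈ H := by
  constructor
  · rintro ⟨h, hh, rfl⟩
    simpa [mul_assoc] using hh
  · intro h
    exact ⟨_, h, by simp [mul_assoc]⟩

/-- `H` is a maximal subgroup of `A`. -/
structure MaximalIn (H A : Subgroup Γ) : Prop where
  lt : H < A
  eq_or_eq : ∀ M, H ≤ M → M ≤ A → M = H ∨ M = A

theorem MaximalIn.eq_of_mem {H A M : Subgroup Γ} (h : MaximalIn H A) (hHM : H ≤ M) (hMA : M ≤ A)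
    {g : Γ} (hg : g ∈ M) (hgH : g ∉ H) : M = A :=
  (h.eq_or_eq M hHM hMA).resolve_left fun e => hgH (e ▸ hg)

/-- Suppose `p` is in neither set on the right. The elements of `A` conjugating the `p`-elements of
`H` into `H` form a subgroup containing `H` and `g⁻¹`, hence all of `A`. Since `p ∤ |A : H|`, each
`p`-element of `A` fixes a coset, so it is conjugate into `H` and thus lies in `H`. -/
theorem MaximalIn.elementPrimes_subset [Finite Γ] {A H : Subgroup Γ} (hmax : MaximalIn H A) {g : Γ}
    (hgA : g ∈ A) (hgH : g ∉ H) :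
    elementPrimes A H ⊆ (H.relIndex A).primeFactors ∪ elementPrimes H (H ⊓ conjSubgroup g H) := by
  rintro p ⟨hp, u, huA, huH, k, hk⟩
  by_contra hcon
  rw [Set.mem_union, not_or] at hcon
  have hmem : ∀ h ∈ H, (∃ k : ℕ, h ^ p ^ k = 1) → g⁻¹ * h * g ∈ H := by
    intro h hh hpk
    by_contra hc
    exact hcon.2 ⟨hp, h, hh, fun h' => hc (mem_conjSubgroup.1 h'.2), hpk⟩
  have hconj : ∀ (a h : Γ), (∃ k : ℕ, h ^ p ^ k = 1) → ∃ k : ℕ, (a * h * a⁻¹) ^ p ^ k = 1 := by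
    rintro a h ⟨k, hk⟩
    exact ⟨k, by rw [conj_pow, hk]; simp⟩
  let P : Γ → Prop := fun a => a ∈ A ∧ ∀ h ∈ H, (∃ k : ℕ, h ^ p ^ k = 1) → a * h * a⁻¹ ∈ H
  have hPmul : ∀ a b, P a → P b → P (a * b) := by
    intro a b ha hb
    refine ⟨A.mul_mem ha.1 hb.1, fun h hh hpk => ?_⟩
    have := ha.2 _ (hb.2 h hh hpk) (hconj b h hpk)
    simpa [mul_assoc] using this
  have hP1 : P 1 := ⟨A.one_mem, fun h hh _ => by simpa using hh⟩
  let M : Subgroup Γ :=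
    { carrier := {a | P a}
      mul_mem' := fun {a b} ha hb => hPmul a b ha hb
      one_mem' := hP1
      -- Closure under products suffices, because in a finite group an inverse is a positive power
      -- or `1`.
      inv_mem' := by
        intro a ha
        have hpow : ∀ n : ℕ, P (a ^ n) := by
          intro n
          induction n with
          | zero => simpa using hP1
          | succ n ih => rw [pow_succ]; exact hPmul _ _ ih ha
        have : a⁻¹ = a ^ (orderOf a - 1) := by
          rw [inv_eq_iff_mul_eq_one, ← pow_succ', Nat.sub_add_cancel (orderOf_pos a),
            pow_orderOf_eq_one]
        change P a⁻¹
        rw [this]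
        exact hpow _ }
  have hHM : H ≤ M := fun a ha =>
    ⟨hmax.lt.le ha, fun h hh _ => H.mul_mem (H.mul_mem ha hh) (H.inv_mem ha)⟩
  have hgM : g⁻¹ ∈ M := ⟨A.inv_mem hgA, fun h hh hpk => by simpa using hmem h hh hpk⟩
  have hMA : M = A := hmax.eq_of_mem hHM (fun a ha => ha.1) hgM
    (fun h => hgH (by simpa using H.inv_mem h))
  have hnd : ¬ p ∣ Nat.card (↥A ⧸ H.subgroupOf A) := fun hd =>
    hcon.1 (by
      rw [Finset.mem_coe, Nat.mem_primeFactors]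
      exact ⟨hp, hd, Subgroup.relIndex_ne_zero_of_finite H A⟩)
  have hpg : IsPGroup p (Subgroup.zpowers (⟨u, huA⟩ : A)) := by
    rintro ⟨_, n, rfl⟩
    refine ⟨k, ?_⟩
    apply Subtype.ext
    apply Subtype.ext
    simp only [Subgroup.coe_pow, Subgroup.coe_zpow, Subgroup.coe_one]
    rw [← zpow_natCast, ← zpow_mul, mul_comm, zpow_mul, zpow_natCast, hk, one_zpow]
  have : Fact p.Prime := ⟨hp⟩
  obtain ⟨q, hq⟩ := hpg.nonempty_fixed_point_of_prime_not_dvd_card _ hnd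
  obtain ⟨a, ha⟩ := QuotientGroup.mk_surjective q
  have h1 := hq ⟨⟨u, huA⟩, Subgroup.mem_zpowers _⟩
  rw [← ha] at h1
  have h2 : ((⟨u, huA⟩ * a : A) : ↥A ⧸ H.subgroupOf A) = (a : ↥A ⧸ H.subgroupOf A) := h1
  rw [eq_comm, QuotientGroup.eq, Subgroup.mem_subgroupOf] at h2
  have h3 : (a : Γ)⁻¹ * u * a ∈ H := by simpa [mul_assoc] using h2
  have haM : (a : Γ) ∈ M := by rw [hMA]; exact a.2
  have h4 := haM.2 _ h3 (by simpa using hconj (a : Γ)⁻¹ u ⟨k, hk⟩)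
  exact huH (by simpa [mul_assoc] using h4)

/-! ### Orbit lengths of `H` on cosets -/

section DoubleCosets

open MulAction

theorem ncard_orbit_coset (H : Subgroup Γ) (g : Γ) :
    (orbit H (g : Γ ⧸ H)).ncard = (conjSubgroup g H).relIndex H := by
  rw [← index_stabilizer]
  change _ = ((conjSubgroup g H).subgroupOf H).index
  congr 1
  ext h
  rw [mem_stabilizer_iff, Subgroup.mem_subgroupOf, mem_conjSubgroup]
  have : h • (g : Γ ⧸ H) = ((h * g : Γ) : Γ ⧸ H) := rfl
  rw [this, eq_comm, QuotientGroup.eq, mul_assoc]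

/-- Paired orbits have equal length: after conjugating by `g`, both indices are those of `H ∩ gHg⁻¹`
in groups of the same order. -/
theorem relIndex_conjSubgroup_inv [Finite Γ] (H : Subgroup Γ) (g : Γ) :
    (conjSubgroup g⁻¹ H).relIndex H = (conjSubgroup g H).relIndex H := by
  have h1 : (conjSubgroup g (conjSubgroup g⁻¹ H)) = H := by
    ext x
    simp [mem_conjSubgroup, mul_assoc]
  have h2 : (conjSubgroup g⁻¹ H).relIndex H = H.relIndex (conjSubgroup g H) := by
    conv_rhs => rw [← h1]
    have := Subgroup.relIndex_map_map_of_injective (conjSubgroup g⁻¹ H) H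
      (f := (MulAut.conj g).toMonoidHom) (MulAut.conj g).injective
    rw [← this]
    change (conjSubgroup g (conjSubgroup g⁻¹ H)).relIndex (conjSubgroup g H) = _
    rw [h1]
  have hc : Nat.card (conjSubgroup g H) = Nat.card H :=
    Subgroup.card_map_of_injective (MulAut.conj g).injective
  have key : ∀ A B : Subgroup Γ, Nat.card (A ⊓ B : Subgroup Γ) * A.relIndex B = Nat.card B := by
    intro A B
    rw [← Subgroup.inf_relIndex_right, ← Subgroup.relIndex_bot_left,
      ← Subgroup.relIndex_bot_left (H := B)]
    exact Subgroup.relIndex_mul_relIndex _ _ _ bot_le inf_le_right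
  have e1 := key H (conjSubgroup g H)
  have e2 := key (conjSubgroup g H) H
  rw [inf_comm, hc, ← e2] at e1
  rw [h2]
  exact Nat.eq_of_mul_eq_mul_left Nat.card_pos e1

theorem one_notMem_orbit {H : Subgroup Γ} {g : Γ} (hg : g ∉ H) :
    ((1 : Γ) : Γ ⧸ H) ∉ orbit H (g : Γ ⧸ H) := by
  rintro ⟨h, hh⟩
  have h1 : ((h * g : Γ) : Γ ⧸ H) = ((1 : Γ) : Γ ⧸ H) := hh
  rw [eq_comm, QuotientGroup.eq] at h1
  refine hg ?_
  have : (h : Γ) * g ∈ H := by simpa using h1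
  exact (Subgroup.mul_mem_cancel_left H h.2).1 this

theorem relIndex_conjSubgroup_lt_index [Finite Γ] {H : Subgroup Γ} {g : Γ} (hg : g ∉ H) :
    (conjSubgroup g H).relIndex H < H.index := by
  rw [← ncard_orbit_coset, Subgroup.index, ← Set.ncard_univ]
  exact Set.ncard_lt_ncard ⟨Set.subset_univ _, fun h => one_notMem_orbit hg (h trivial)⟩

/-- If the orbits of `gH` and `g⁻¹H` met, some `h ∈ H` would give `(gh)² ∈ H`, hence `g ∈ H`. So
they are disjoint, of equal length, and both miss the base coset. -/
theorem two_mul_relIndex_conjSubgroup_lt_index [Finite Γ] {H : Subgroup Γ} {g : Γ} (hg : g ∉ H)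
    (hsq : ∀ u : Γ, u ^ 2 ∈ H → u ∈ H) :
    2 * (conjSubgroup g H).relIndex H < H.index := by
  have hg' : g⁻¹ ∉ H := fun h => hg (by simpa using H.inv_mem h)
  have hdisj : Disjoint (orbit H (g : Γ ⧸ H)) (orbit H ((g⁻¹ : Γ) : Γ ⧸ H)) := by
    refine (orbit.eq_or_disjoint (G := H) (g : Γ ⧸ H) ((g⁻¹ : Γ) : Γ ⧸ H)).resolve_left fun e => ?_
    have h1 : ((g⁻¹ : Γ) : Γ ⧸ H) ∈ orbit H (g : Γ ⧸ H) := e ▸ mem_orbit_self _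
    obtain ⟨h, hh⟩ := h1
    have h2 : ((h * g : Γ) : Γ ⧸ H) = ((g⁻¹ : Γ) : Γ ⧸ H) := hh
    rw [eq_comm, QuotientGroup.eq, inv_inv] at h2
    have h3 : (g * h) ^ 2 ∈ H := by
      have := H.mul_mem h2 h.2
      simpa [pow_two, mul_assoc] using this
    exact hg ((Subgroup.mul_mem_cancel_right H h.2).1 (hsq _ h3))
  have h1 : (orbit H (g : Γ ⧸ H) ∪ orbit H ((g⁻¹ : Γ) : Γ ⧸ H)).ncard =
      2 * (conjSubgroup g H).relIndex H := by
    rw [Set.ncard_union_eq hdisj, ncard_orbit_coset, ncard_orbit_coset,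
      relIndex_conjSubgroup_inv, two_mul]
  rw [← h1, Subgroup.index, ← Set.ncard_univ]
  exact Set.ncard_lt_ncard ⟨Set.subset_univ _, fun h =>
    (h (Set.mem_univ ((1 : Γ) : Γ ⧸ H))).elim (one_notMem_orbit hg) (one_notMem_orbit hg')⟩

theorem conjSubgroup_subgroupOf {A H : Subgroup Γ} (g : A) :
    conjSubgroup g (H.subgroupOf A) = (conjSubgroup (g : Γ) H).subgroupOf A := by
  ext x
  simp [mem_conjSubgroup, Subgroup.mem_subgroupOf]

theorem relIndex_inf_conjSubgroup_lt [Finite Γ] {A H : Subgroup Γ} (hHA : H ≤ A) {g : Γ} (hgA : g ∈ A)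
    (hg : g ∉ H) : (H ⊓ conjSubgroup g H).relIndex H < H.relIndex A := by
  have := relIndex_conjSubgroup_lt_index (H := H.subgroupOf A) (g := ⟨g, hgA⟩)
    (by simpa [Subgroup.mem_subgroupOf] using hg)
  rw [conjSubgroup_subgroupOf, Subgroup.relIndex_subgroupOf hHA] at this
  rwa [inf_comm, Subgroup.inf_relIndex_right]

theorem two_mul_relIndex_inf_conjSubgroup_lt [Finite Γ] {A H : Subgroup Γ} (hHA : H ≤ A) {g : Γ}
    (hgA : g ∈ A) (hg : g ∉ H) (hsq : ∀ u ∈ A, u ^ 2 ∈ H → u ∈ H) :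
    2 * (H ⊓ conjSubgroup g H).relIndex H < H.relIndex A := by
  have := two_mul_relIndex_conjSubgroup_lt_index (H := H.subgroupOf A) (g := ⟨g, hgA⟩)
    (by simpa [Subgroup.mem_subgroupOf] using hg)
    (fun u hu => by
      rw [Subgroup.mem_subgroupOf] at hu ⊢
      exact hsq u u.2 (by simpa using hu))
  rw [conjSubgroup_subgroupOf, Subgroup.relIndex_subgroupOf hHA] at this
  rwa [inf_comm, Subgroup.inf_relIndex_right]

end DoubleCosets

/-! ### Logarithmic estimates and the case without elements of order two modulo `H` -/

theorem Nat.two_pow_card_primeFactors_le {n : ℕ} (hn : n ≠ 0) : 2 ^ n.primeFactors.card ≤ n := by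
  calc 2 ^ n.primeFactors.card ≤ ∏ p ∈ n.primeFactors, p :=
        Finset.pow_card_le_prod _ _ _ fun p hp => (Nat.prime_of_mem_primeFactors hp).two_le
    _ ≤ n := Nat.le_of_dvd (Nat.pos_of_ne_zero hn) (Nat.prod_primeFactors_dvd n)

theorem Nat.card_primeFactors_le_logb {n : ℕ} (hn : n ≠ 0) :
    (n.primeFactors.card : ℝ) ≤ Real.logb 2 n := by
  rw [Real.le_logb_iff_rpow_le one_lt_two (by exact_mod_cast Nat.pos_of_ne_zero hn),
    Real.rpow_natCast]
  exact_mod_cast Nat.two_pow_card_primeFactors_le hn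

theorem MaximalIn.or_exists_between {H A : Subgroup Γ} (h : H < A) :
    MaximalIn H A ∨ ∃ M, H < M ∧ M < A := by
  by_contra hcon
  push Not at hcon
  refine hcon.1 ⟨h, fun M hM hMA => ?_⟩
  by_contra hne
  push Not at hne
  exact hcon.2 M (lt_of_le_of_ne hM (Ne.symm hne.1)) (lt_of_le_of_ne hMA hne.2)

theorem Subgroup.one_lt_relIndex_of_lt [Finite Γ] {H A : Subgroup Γ} (h : H < A) :
    1 < H.relIndex A := by
  have h0 := Subgroup.relIndex_ne_zero_of_finite H A
  have h1 : H.relIndex A ≠ 1 := fun e => h.not_ge (Subgroup.relIndex_eq_one.1 e)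
  omega

theorem logb_sq_add_logb_sq_le {a b : ℕ} (ha : 1 ≤ a) (hb : 1 ≤ b) :
    Real.logb 2 a ^ 2 + Real.logb 2 b ^ 2 ≤ Real.logb 2 (a * b : ℕ) ^ 2 := by
  have ha' : (1 : ℝ) ≤ a := by exact_mod_cast ha
  have hb' : (1 : ℝ) ≤ b := by exact_mod_cast hb
  rw [Nat.cast_mul, Real.logb_mul (by positivity) (by positivity)]
  have := Real.logb_nonneg one_lt_two ha'
  have := Real.logb_nonneg one_lt_two hb'
  nlinarith [mul_nonneg (Real.logb_nonneg one_lt_two ha') (Real.logb_nonneg one_lt_two hb')]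

theorem one_le_logb_two {n : ℕ} (hn : 2 ≤ n) : 1 ≤ Real.logb 2 n := by
  rw [Real.le_logb_iff_rpow_le one_lt_two (by positivity), Real.rpow_one]
  exact_mod_cast hn

theorem mem_of_sq_mem_of_two_notMem [Finite Γ] {A H : Subgroup Γ} (h2 : 2 ∉ elementPrimes A H)
    {u : Γ} (hu : u ∈ A) (hsq : u ^ 2 ∈ H) : u ∈ H := by
  obtain ⟨k, m, hm, hord⟩ := Nat.exists_eq_pow_mul_and_not_dvd
    (orderOf_pos u).ne' 2 (by norm_num)
  refine mem_of_pow_mem_of_coprime ((Nat.Prime.coprime_iff_not_dvd Nat.prime_two).2 hm) hsq ?_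
  by_contra hmH
  refine h2 ⟨Nat.prime_two, u ^ m, A.pow_mem hu m, hmH, k, ?_⟩
  rw [← pow_mul, mul_comm, ← hord, pow_orderOf_eq_one]

theorem two_notMem_elementPrimes {A H : Subgroup Γ} (hsq : ∀ u ∈ A, u ^ 2 ∈ H → u ∈ H) :
    2 ∉ elementPrimes A H := by
  rintro ⟨_, g, hgA, hgH, k, hk⟩
  refine hgH ?_
  have : g ^ 2 ^ k ∈ H := by rw [hk]; exact H.one_mem
  clear hk
  induction k with
  | zero => simpa using this
  | succ k ih => exact ih (hsq _ (A.pow_mem hgA _) (by rwa [← pow_mul, ← pow_succ]))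

/-- A 2-element of `H` outside `gHg⁻¹` has a conjugate in `A` outside `H`. This carries the
hypothesis on 2 through the induction in `ncard_elementPrimes_le`. -/
theorem two_notMem_elementPrimes_inf_conj {A H : Subgroup Γ} (hHA : H ≤ A)
    (h2 : 2 ∉ elementPrimes A H) {g : Γ} (hg : g ∈ A) :
    2 ∉ elementPrimes H (H ⊓ conjSubgroup g H) := by
  rintro ⟨hp, h, hhH, hh, k, hk⟩
  refine hh ⟨hhH, mem_conjSubgroup.2 ?_⟩
  by_contra hcon
  refine h2 ⟨hp, _, A.mul_mem (A.mul_mem (A.inv_mem hg) (hHA hhH)) hg, hcon, k, ?_⟩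
  have : g⁻¹ * h * g = g⁻¹ * h * (g⁻¹)⁻¹ := by simp
  rw [this, conj_pow, hk]
  simp

theorem elementPrimes_self (A : Subgroup Γ) : elementPrimes A A = ∅ := by
  ext p
  simp only [Set.mem_empty_iff_false, iff_false]
  rintro ⟨_, g, h, h', _⟩
  exact h' h

theorem residualPrimes_self (A : Subgroup Γ) : residualPrimes A A = ∅ := by
  ext p
  simp only [Set.mem_empty_iff_false, iff_false]
  rintro ⟨_, h⟩
  exact h rfl

theorem ncard_elementPrimes_le [Finite Γ] (n : ℕ) : ∀ A H : Subgroup Γ, H ≤ A →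
    H.relIndex A = n → 2 ∉ elementPrimes A H →
    ((elementPrimes A H).ncard : ℝ) ≤ Real.logb 2 n ^ 2 := by
  induction n using Nat.strong_induction_on with
  | _ n ih =>
  intro A H hHA hn h2
  rcases hHA.eq_or_lt with rfl | hlt
  · rw [elementPrimes_self, Set.ncard_empty, Nat.cast_zero]
    positivity
  have hn2 : 2 ≤ n := hn ▸ Subgroup.one_lt_relIndex_of_lt hlt
  rcases MaximalIn.or_exists_between hlt with hmax | ⟨M, hHM, hMA⟩
  · obtain ⟨g, hgA, hgH⟩ := SetLike.exists_of_lt hlt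
    have hd := two_mul_relIndex_inf_conjSubgroup_lt hHA hgA hgH
      (fun u hu hs => mem_of_sq_mem_of_two_notMem h2 hu hs)
    have hd0 := Subgroup.relIndex_ne_zero_of_finite (H ⊓ conjSubgroup g H) H
    set d := (H ⊓ conjSubgroup g H).relIndex H with hd_def
    rw [hn] at hd
    have hih := ih d (by omega) H (H ⊓ conjSubgroup g H) inf_le_left rfl
      (two_notMem_elementPrimes_inf_conj hHA h2 hgA)
    have hsub := hmax.elementPrimes_subset hgA hgH
    have hle : (elementPrimes A H).ncard ≤
        n.primeFactors.card + (elementPrimes H (H ⊓ conjSubgroup g H)).ncard := by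
      refine (Set.ncard_le_ncard hsub
        ((Finset.finite_toSet _).union (elementPrimes_finite _ _))).trans ?_
      refine (Set.ncard_union_le _ _).trans ?_
      rw [Set.ncard_coe_finset, hn]
    have hle' : ((elementPrimes A H).ncard : ℝ) ≤
        n.primeFactors.card + (elementPrimes H (H ⊓ conjSubgroup g H)).ncard := by
      exact_mod_cast hle
    have hpf := Nat.card_primeFactors_le_logb (show n ≠ 0 by omega)
    have hd1 : (1 : ℝ) ≤ d := by exact_mod_cast Nat.one_le_iff_ne_zero.2 hd0
    have hlog0 := Real.logb_nonneg one_lt_two hd1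
    have hlogd : Real.logb 2 d + 1 ≤ Real.logb 2 n := by
      have h1 : Real.logb 2 (2 * d) = 1 + Real.logb 2 d := by
        rw [Real.logb_mul two_ne_zero (by positivity), Real.logb_self_eq_one one_lt_two]
      rw [add_comm, ← h1]
      exact Real.logb_le_logb_of_le one_lt_two (by positivity) (by exact_mod_cast hd.le)
    -- With `L = log₂ n ≥ 1` and `0 ≤ log₂ d ≤ L - 1`, the count is at most `L + (L - 1)² ≤ L²`.
    nlinarith
  · have hmul := Subgroup.relIndex_mul_relIndex H M A hHM.le hMA.le
    have h1 := Subgroup.one_lt_relIndex_of_lt hHM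
    have h3 := Subgroup.one_lt_relIndex_of_lt hMA
    rw [hn] at hmul
    have i1 := ih (M.relIndex A) (by nlinarith) A M hMA.le rfl
      (fun ⟨hp, g, hg, hgM, hk⟩ => h2 ⟨hp, g, hg, fun h => hgM (hHM.le h), hk⟩)
    have i2 := ih (H.relIndex M) (by nlinarith) M H hHM.le rfl
      (fun ⟨hp, g, hg, hgM, hk⟩ => h2 ⟨hp, g, hMA.le hg, hgM, hk⟩)
    have hle : (elementPrimes A H).ncard ≤
        (elementPrimes A M).ncard + (elementPrimes M H).ncard :=
      (Set.ncard_le_ncard (elementPrimes_subset_union A M H)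
        ((elementPrimes_finite _ _).union (elementPrimes_finite _ _))).trans
        (Set.ncard_union_le _ _)
    have hle' : ((elementPrimes A H).ncard : ℝ) ≤
        (elementPrimes A M).ncard + (elementPrimes M H).ncard := by exact_mod_cast hle
    have := logb_sq_add_logb_sq_le h1.le h3.le
    rw [hmul] at this
    linarith

/-! ### Maximal subgroups with an abelian normal section above the core -/

section AbelianSocle

variable {A H K N : Subgroup Γ}

/-- Each new generator at least doubles the subgroup reached so far. Generators are kept outside `K`
so that their conjugates are nontrivial modulo `K`. -/
theorem exists_finset_generators [Finite Γ] (N : Subgroup Γ) (m : ℕ) :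
    ∀ K : Subgroup Γ, K ≤ N → K.relIndex N = m → ∃ S : Finset Γ, (∀ s ∈ S, s ∈ N ∧ s ∉ K) ∧
      N ≤ K ⊔ Subgroup.closure (S : Set Γ) ∧ 2 ^ S.card ≤ m := by
  classical
  induction m using Nat.strong_induction_on with
  | _ m ih =>
  intro K hKN hm
  rcases hKN.eq_or_lt with rfl | hlt
  · refine ⟨∅, by simp, le_sup_left, ?_⟩
    rw [← hm, Subgroup.relIndex_self]
    simp
  obtain ⟨v, hvN, hvK⟩ := SetLike.exists_of_lt hlt
  have hKK' : K < K ⊔ Subgroup.zpowers v := by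
    refine lt_of_le_of_ne le_sup_left fun e => hvK ?_
    rw [e]
    exact (le_sup_right : Subgroup.zpowers v ≤ _) (Subgroup.mem_zpowers v)
  have hK'N : K ⊔ Subgroup.zpowers v ≤ N := sup_le hKN (Subgroup.zpowers_le.2 hvN)
  have h1 := Subgroup.one_lt_relIndex_of_lt hKK'
  have hmul := Subgroup.relIndex_mul_relIndex _ _ _ hKK'.le hK'N
  have h0 := Subgroup.relIndex_ne_zero_of_finite (K ⊔ Subgroup.zpowers v) N
  rw [hm] at hmul
  obtain ⟨S, hS, hgen, hcard⟩ := ih _ (by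
    have := Nat.pos_of_ne_zero h0
    nlinarith) (K ⊔ Subgroup.zpowers v) hK'N rfl
  refine ⟨insert v S, ?_, ?_, ?_⟩
  · intro s hs
    rcases Finset.mem_insert.1 hs with rfl | hs
    · exact ⟨hvN, hvK⟩
    · exact ⟨(hS s hs).1, fun h => (hS s hs).2 (hKK'.le h)⟩
  · refine hgen.trans (sup_le (sup_le le_sup_left ?_) ?_)
    · refine le_trans (Subgroup.zpowers_le.2 (Subgroup.subset_closure ?_)) le_sup_right
      simp
    · refine le_trans (Subgroup.closure_mono ?_) le_sup_right
      simp
  · calc 2 ^ (insert v S).card ≤ 2 ^ (S.card + 1) :=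
          Nat.pow_le_pow_right (by norm_num) (Finset.card_insert_le v S)
      _ = 2 * 2 ^ S.card := by rw [pow_succ, mul_comm]
      _ ≤ _ := by rw [← hmul]; exact Nat.mul_le_mul h1 hcard

/-- The elements of `H` that centralize `N` modulo `K`. -/
def centralizerMod (hK : NormalIn K A) (hHA : H ≤ A) (N : Subgroup Γ) : Subgroup Γ where
  carrier := {h | h ∈ H ∧ ∀ v ∈ N, h * v * h⁻¹ * v⁻¹ ∈ K}
  mul_mem' := by
    rintro a b ⟨ha, ha'⟩ ⟨hb, hb'⟩
    refine ⟨H.mul_mem ha hb, fun v hv => ?_⟩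
    have := K.mul_mem (hK.2 a (hHA ha) _ (hb' v hv)) (ha' v hv)
    simpa [mul_assoc] using this
  one_mem' := ⟨H.one_mem, fun v _ => by simp⟩
  inv_mem' := by
    rintro a ⟨ha, ha'⟩
    refine ⟨H.inv_mem ha, fun v hv => ?_⟩
    have := hK.2 a⁻¹ (A.inv_mem (hHA ha)) _ (K.inv_mem (ha' v hv))
    simpa [mul_assoc] using this

/-- The largest subgroup of `H` that is normal in `A`. -/
def coreIn (A H : Subgroup Γ) : Subgroup Γ :=
  ⨅ a : A, conjSubgroup (a : Γ) H

theorem mem_coreIn {x : Γ} : x ∈ coreIn A H ↔ ∀ a ∈ A, a⁻¹ * x * a ∈ H := by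
  simp [coreIn, Subgroup.mem_iInf, mem_conjSubgroup]

theorem coreIn_le : coreIn A H ≤ H := fun x hx => by
  simpa using mem_coreIn.1 hx 1 A.one_mem

theorem coreIn_normalIn (hHA : H ≤ A) : NormalIn (coreIn A H) A := by
  refine ⟨coreIn_le.trans hHA, fun a ha k hk => mem_coreIn.2 fun b hb => ?_⟩
  have := mem_coreIn.1 hk (a⁻¹ * b) (A.mul_mem (A.inv_mem ha) hb)
  simpa [mul_assoc] using this

theorem le_coreIn {C : Subgroup Γ} (hC : NormalIn C A) (hCH : C ≤ H) : C ≤ coreIn A H :=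
  fun x hx => mem_coreIn.2 fun a ha => hCH (by
    simpa using hC.2 a⁻¹ (A.inv_mem ha) x hx)

theorem MaximalIn.exists_eq_mul (hmax : MaximalIn H A) (hN : NormalIn N A)
    (hlt : coreIn A H < N) {a : Γ} (ha : a ∈ A) : ∃ h ∈ H, ∃ u ∈ N, a = h * u := by
  obtain ⟨g, hgN, hgH⟩ : ∃ g ∈ N, g ∉ H := by
    by_contra hcon
    push Not at hcon
    exact hlt.not_ge (le_coreIn hN hcon)
  have : H ⊔ N = A := hmax.eq_of_mem le_sup_left (sup_le hmax.lt.le hN.1)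
    ((le_sup_right : N ≤ H ⊔ N) hgN) hgH
  rw [← this] at ha
  exact (Subgroup.mem_sup_of_conj_mem fun b hb => hN.2 b (hmax.lt.le hb)).1 ha

/-- The centralizer is normalized by `H`, and by `N` because its commutators with `N` lie in the
core. As `A = HN`, it is normal in `A` and contained in `H`. -/
theorem centralizerMod_le_coreIn (hmax : MaximalIn H A) (hN : NormalIn N A)
    (hlt : coreIn A H < N) :
    centralizerMod (coreIn_normalIn hmax.lt.le) hmax.lt.le N ≤ coreIn A H := by
  have hHA := hmax.lt.le
  have hK := coreIn_normalIn hHA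
  refine le_coreIn ⟨fun x hx => hHA hx.1, fun a ha c hc => ?_⟩ fun x hx => hx.1
  obtain ⟨h, hh, u, hu, rfl⟩ := hmax.exists_eq_mul hN hlt ha
  have hc' : u * c * u⁻¹ ∈ centralizerMod hK hHA N := by
    have hk : c⁻¹ * u * c * u⁻¹ ∈ coreIn A H := by
      simpa using ((centralizerMod hK hHA N).inv_mem hc).2 u hu
    have hkC : c⁻¹ * u * c * u⁻¹ ∈ centralizerMod hK hHA N := by
      refine ⟨coreIn_le hk, fun v hv => ?_⟩
      have := (coreIn A H).mul_mem hk (hK.2 v (hN.1 hv) _ ((coreIn A H).inv_mem hk))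
      simpa only [mul_assoc] using this
    have := (centralizerMod hK hHA N).mul_mem hc hkC
    simpa [mul_assoc] using this
  refine ⟨?_, fun v hv => ?_⟩
  · have := H.mul_mem (H.mul_mem hh hc'.1) (H.inv_mem hh)
    simpa [mul_assoc] using this
  · have hw : h⁻¹ * v * h ∈ N := by
      simpa using hN.2 h⁻¹ (A.inv_mem (hHA hh)) v hv
    have := hK.2 h (hHA hh) _ (hc'.2 _ hw)
    simpa [mul_assoc] using this

/-- As `N` is abelian modulo the core, `H ∩ N` centralizes it and so equals the core; then `A = HN`
gives the index. -/
theorem coreIn_relIndex_eq (hmax : MaximalIn H A) (hN : NormalIn N A) (hlt : coreIn A H < N)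
    (hab : ∀ u ∈ N, ∀ v ∈ N, u * v * u⁻¹ * v⁻¹ ∈ coreIn A H) :
    (coreIn A H).relIndex N = H.relIndex A := by
  have hinf : H ⊓ N = coreIn A H := by
    apply le_antisymm
    · exact fun x hx => centralizerMod_le_coreIn hmax hN hlt ⟨hx.1, hab x hx.2⟩
    · exact le_inf coreIn_le hlt.le
  rw [← hinf, Subgroup.inf_relIndex_right]
  symm
  refine Subgroup.relIndex_eq_of_forall_eq_mul hN.1 fun v hv => ?_
  obtain ⟨h, hh, u, hu, e⟩ := hmax.exists_eq_mul hN hlt (A.inv_mem hv)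
  refine ⟨u⁻¹, N.inv_mem hu, h⁻¹, H.inv_mem hh, ?_⟩
  rw [← mul_inv_rev, ← e, inv_inv]

/-- An element of `H` is determined modulo the core by where it sends the `a` generators of `N`, and
each image is one of `n - 1` nontrivial cosets. -/
theorem coreIn_relIndex_le [Finite Γ] (hmax : MaximalIn H A) (hN : NormalIn N A)
    (hlt : coreIn A H < N)
    (hab : ∀ u ∈ N, ∀ v ∈ N, u * v * u⁻¹ * v⁻¹ ∈ coreIn A H) :
    ∃ a : ℕ, 2 ^ a ≤ H.relIndex A ∧
      (coreIn A H).relIndex H ≤ (H.relIndex A - 1) ^ a := by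
  have hHA := hmax.lt.le
  have hK := coreIn_normalIn hHA
  have hKN := coreIn_relIndex_eq hmax hN hlt hab
  obtain ⟨S, hS, hgen, hcard⟩ := exists_finset_generators N _ (coreIn A H) hlt.le rfl
  refine ⟨S.card, hKN ▸ hcard, ?_⟩
  set K := coreIn A H with hKdef
  have hconjN : ∀ h ∈ H, ∀ s ∈ S, h * s * h⁻¹ ∈ N := fun h hh s hs =>
    hN.2 h (hHA hh) s (hS s hs).1
  have hconjK : ∀ h ∈ H, ∀ s ∈ S, h * s * h⁻¹ ∉ K := fun h hh s hs hmem =>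
    (hS s hs).2 (by simpa [mul_assoc] using hK.2 h⁻¹ (A.inv_mem (hHA hh)) _ hmem)
  let one : ↥N ⧸ K.subgroupOf N := ((1 : N) : ↥N ⧸ K.subgroupOf N)
  let f : H → S → {q : ↥N ⧸ K.subgroupOf N // q ≠ one} := fun h s =>
    ⟨((⟨h * s * (h : Γ)⁻¹, hconjN h h.2 s s.2⟩ : N) : ↥N ⧸ K.subgroupOf N), fun e => by
      rw [eq_comm, QuotientGroup.eq, Subgroup.mem_subgroupOf] at e
      exact hconjK h h.2 s s.2 (by simpa using e)⟩
  have hf : ∀ h h' : H, f h = f h' → (h : Γ)⁻¹ * h' ∈ K := by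
    intro h h' e
    refine centralizerMod_le_coreIn hmax hN hlt
      ⟨H.mul_mem (H.inv_mem h.2) h'.2, fun v hv => ?_⟩
    set c : Γ := (h : Γ)⁻¹ * h' with hc
    -- `D` consists of the elements commuting with `c` modulo `K`; it contains `K` and the
    -- generators, hence `N`.
    let D : Subgroup Γ :=
      { carrier := {v | v ∈ A ∧ v⁻¹ * c * v * c⁻¹ ∈ K}
        mul_mem' := by
          rintro v w ⟨hv, hv'⟩ ⟨hw, hw'⟩
          refine ⟨A.mul_mem hv hw, ?_⟩
          have := K.mul_mem (hK.2 w⁻¹ (A.inv_mem hw) _ hv') hw'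
          simpa [mul_assoc] using this
        one_mem' := ⟨A.one_mem, by simp⟩
        inv_mem' := by
          rintro v ⟨hv, hv'⟩
          refine ⟨A.inv_mem hv, ?_⟩
          have := hK.2 v hv _ (K.inv_mem hv')
          simpa [mul_assoc] using this }
    have hcA : c ∈ A := hHA (H.mul_mem (H.inv_mem h.2) h'.2)
    have hND : N ≤ D := by
      refine hgen.trans (sup_le (fun k hk => ⟨hK.1 hk, ?_⟩)
        ((Subgroup.closure_le _).2 fun s hs => ⟨hN.1 (hS s hs).1, ?_⟩))
      · have := K.mul_mem (K.inv_mem hk) (hK.2 c hcA k hk)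
        simpa [mul_assoc] using this
      · have e1 := congrArg Subtype.val (congrFun e ⟨s, hs⟩)
        have e2 : ((⟨h * s * (h : Γ)⁻¹, hconjN h h.2 s hs⟩ : N) : ↥N ⧸ K.subgroupOf N) =
          ((⟨h' * s * (h' : Γ)⁻¹, hconjN h' h'.2 s hs⟩ : N) : ↥N ⧸ K.subgroupOf N) := e1
        rw [QuotientGroup.eq, Subgroup.mem_subgroupOf] at e2
        have e3 := hK.2 (h : Γ)⁻¹ (A.inv_mem (hHA h.2)) _ e2
        simpa [hc, mul_assoc] using e3
    have h1 := (hND (N.inv_mem hv)).2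
    simpa [mul_assoc] using K.inv_mem h1
  have hinj : Function.Injective fun q : ↥H ⧸ K.subgroupOf H => f q.out := by
    intro q q' e
    rw [← QuotientGroup.out_eq' q, ← QuotientGroup.out_eq' q', QuotientGroup.eq,
      Subgroup.mem_subgroupOf]
    exact hf _ _ e
  have hle := Nat.card_le_card_of_injective _ hinj
  refine hle.trans (le_of_eq ?_)
  have hcompl : Nat.card {q : ↥N ⧸ K.subgroupOf N // q ≠ one} = H.relIndex A - 1 := by
    have h1 := Set.ncard_compl ({one} : Set (↥N ⧸ K.subgroupOf N))
    rw [Set.ncard_singleton] at h1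
    rw [← hKN]
    exact h1
  rw [Nat.card_fun, hcompl]
  simp

theorem ncard_elementPrimes_lt_of_abelian [Finite Γ] (hmax : MaximalIn H A) (hN : NormalIn N A)
    (hlt : coreIn A H < N)
    (hab : ∀ u ∈ N, ∀ v ∈ N, u * v * u⁻¹ * v⁻¹ ∈ coreIn A H) :
    ((elementPrimes A H).ncard : ℝ) < 2 * Real.logb 2 (H.relIndex A) ^ 2 := by
  obtain ⟨a, ha, hle⟩ := coreIn_relIndex_le hmax hN hlt hab
  have hn2 : 2 ≤ H.relIndex A := Subgroup.one_lt_relIndex_of_lt hmax.lt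
  have hmul := Subgroup.relIndex_mul_relIndex _ _ _ (coreIn_le (A := A)) hmax.lt.le
  have hsub := elementPrimes_subset_of_normalIn (coreIn_normalIn hmax.lt.le) coreIn_le
  have hm0 := Subgroup.relIndex_ne_zero_of_finite (coreIn A H) A
  have hk : ((elementPrimes A H).ncard : ℝ) ≤ ((coreIn A H).relIndex A).primeFactors.card := by
    have := Set.ncard_le_ncard hsub (Finset.finite_toSet _)
    rw [Set.ncard_coe_finset] at this
    exact_mod_cast this
  have hk2 := Nat.card_primeFactors_le_logb hm0
  set n := H.relIndex A
  set m := (coreIn A H).relIndex A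
  have hL := one_le_logb_two hn2
  have haL : (a : ℝ) ≤ Real.logb 2 n := by
    rw [Real.le_logb_iff_rpow_le one_lt_two (by positivity), Real.rpow_natCast]
    exact_mod_cast ha
  have hn1 : (0 : ℝ) < (n - 1 : ℕ) := by
    have : 0 < n - 1 := by omega
    exact_mod_cast this
  have hm : (m : ℝ) ≤ ((n - 1 : ℕ) : ℝ) ^ a * n := by
    rw [← hmul]
    exact_mod_cast Nat.mul_le_mul_right _ hle
  have hlogm : Real.logb 2 m ≤ a * Real.logb 2 (n - 1 : ℕ) + Real.logb 2 n := by
    refine (Real.logb_le_logb_of_le one_lt_two (by positivity) hm).trans (le_of_eq ?_)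
    rw [Real.logb_mul (by positivity) (by positivity), Real.logb_pow]
  have hlt' : Real.logb 2 (n - 1 : ℕ) < Real.logb 2 n :=
    Real.logb_lt_logb one_lt_two hn1 (by exact_mod_cast (by omega : n - 1 < n))
  -- For `a > 0` strictness comes from `a * log₂ (n - 1) < a * log₂ n ≤ L²`; for `a = 0` the bound
  -- is just `L < 2L²`.
  rcases Nat.eq_zero_or_pos a with rfl | hapos
  · simp only [Nat.cast_zero, zero_mul, zero_add] at hlogm
    nlinarith
  · have : (0 : ℝ) < a := by exact_mod_cast hapos
    nlinarith

end AbelianSocle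

/-! ### Maximal subgroups with a nonabelian minimal normal section above the core -/

section NonabelianSocle

variable {A H M N S : Subgroup Γ} {p : ℕ}

/-- `M` is a maximal proper normal subgroup of `N`. -/
structure MaximalNormalIn (M N : Subgroup Γ) : Prop where
  normalIn : NormalIn M N
  ne : M ≠ N
  eq_or_eq : ∀ C, NormalIn C N → M ≤ C → C = M ∨ C = N

theorem MaximalNormalIn.eq_or_eq_of_subnormalIn (h : MaximalNormalIn M N)
    (hS : SubnormalIn S N) (hMS : M ≤ S) : S = M ∨ S = N := by
  have key : ∀ C, SubnormalIn C N → M ≤ C → C = M ∨ C = N := by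
    intro C hC
    induction hC using Relation.ReflTransGen.head_induction_on with
    | refl => exact fun _ => Or.inr rfl
    | head h1 h2 ih =>
      intro hMC
      rcases ih (hMC.trans h1.1) with e | e
      · exact Or.inl (le_antisymm (e ▸ h1.1) hMC)
      · rw [e] at h1
        exact h.eq_or_eq _ h1 hMC
  exact key S hS hMS

theorem MaximalNormalIn.noFactor (h : MaximalNormalIn M N) (hp : p.Prime)
    (hind : M.relIndex N ≠ p) : NoFactor p M N := by
  intro S T hT hS hTS hST
  have hTS' : T ≠ S := fun e => by
    rw [e, Subgroup.relIndex_self] at hST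
    exact hp.one_lt.ne hST
  rcases h.eq_or_eq_of_subnormalIn hS (hT.trans hTS.1) with rfl | rfl
  · exact hTS' (le_antisymm hTS.1 hT)
  · rcases h.eq_or_eq T hTS hT with rfl | rfl
    · exact hind hST
    · exact hTS' rfl

theorem exists_maximalNormalIn [Finite Γ] {K N : Subgroup Γ} (hK : NormalIn K N) (hlt : K < N) :
    ∃ M, K ≤ M ∧ MaximalNormalIn M N := by
  obtain ⟨M, hM, hmax⟩ := Set.Finite.exists_maximal
    (Set.toFinite {M : Subgroup Γ | NormalIn M N ∧ K ≤ M ∧ M ≠ N}) ⟨K, hK, le_rfl, hlt.ne⟩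
  refine ⟨M, hM.2.1, hM.1, hM.2.2, fun C hC hMC => ?_⟩
  by_cases e : C = N
  · exact Or.inr e
  · exact Or.inl (le_antisymm (hmax ⟨hC, hM.2.1.trans hMC, e⟩ hMC) hMC)

theorem NormalIn.commutator_le (hM : NormalIn M N) (hp : p.Prime) (hind : M.relIndex N = p) :
    ⁅N, N⁆ ≤ M := by
  have hn : (M.subgroupOf N).Normal := by
    refine ⟨fun n hn a => ?_⟩
    rw [Subgroup.mem_subgroupOf] at hn ⊢
    exact hM.2 a a.2 n hn
  have : Fact p.Prime := ⟨hp⟩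
  have hcyc : IsCyclic (↥N ⧸ M.subgroupOf N) := isCyclic_of_prime_card hind
  rw [Subgroup.commutator_le]
  intro u hu v hv
  have hcomm := hcyc.isMulCommutative.is_comm.comm
    ((⟨u, hu⟩ : N) : ↥N ⧸ M.subgroupOf N) ((⟨v, hv⟩ : N) : ↥N ⧸ M.subgroupOf N)
  rw [← QuotientGroup.mk_mul, ← QuotientGroup.mk_mul, QuotientGroup.eq,
    Subgroup.mem_subgroupOf] at hcomm
  rw [commutatorElement_def]
  have h2 := hM.2 (u * v) (N.mul_mem hu hv) _ hcomm
  have h3 := M.inv_mem h2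
  simpa [mul_assoc] using h3

theorem NormalIn.commutator (hN : NormalIn N A) : NormalIn ⁅N, N⁆ A := by
  refine ⟨(Subgroup.commutator_le.2 fun u hu v hv => ?_).trans hN.1, fun a ha k hk => ?_⟩
  · exact N.mul_mem (N.mul_mem (N.mul_mem hu hv) (N.inv_mem hu)) (N.inv_mem hv)
  · have hle : N.map (MulAut.conj a).toMonoidHom ≤ N := by
      rintro _ ⟨n, hn, rfl⟩
      exact hN.2 a ha n hn
    have h1 : a * k * a⁻¹ ∈ (⁅N, N⁆).map (MulAut.conj a).toMonoidHom := ⟨k, hk, rfl⟩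
    rw [Subgroup.map_commutator] at h1
    exact Subgroup.commutator_mono hle hle h1

theorem conj_mem_iff_of_normalIn (hN : NormalIn N A) {a : Γ} (ha : a ∈ A) (b : Γ) :
    b ∈ N ↔ a * b * a⁻¹ ∈ N := by
  refine ⟨hN.2 a ha b, fun hb => ?_⟩
  have := hN.2 a⁻¹ (A.inv_mem ha) _ hb
  simpa [mul_assoc] using this

theorem NormalIn.factorResidual [Finite Γ] (hp : p.Prime) (hN : NormalIn N A) :
    NormalIn (factorResidual p N) A :=
  ⟨(factorResidual_le hp N).trans hN.1, fun _ ha _ hk =>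
    conj_mem_factorResidual (conj_mem_iff_of_normalIn hN ha) hk⟩

/-- By minimality, `K` times the residual of `N` is `K`, as wanted, or `N`. In the latter case take
a maximal normal `M ≥ K` of `N`. If `N / M` has order `p`, then `M` contains `⁅N, N⁆`, which
together with `K` generates `N`; otherwise `M` contains the residual. Both contradict `M ≠ N`. -/
theorem noFactor_of_nonabelian_minimal [Finite Γ] {K : Subgroup Γ} (hp : p.Prime)
    (hK : NormalIn K A) (hN : NormalIn N A) (hlt : K < N)
    (hmin : ∀ C, NormalIn C A → K ≤ C → C ≤ N → C = K ∨ C = N)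
    (hnab : ¬ ⁅N, N⁆ ≤ K) : NoFactor p K N := by
  have hR := hN.factorResidual hp
  rcases hmin _ (hK.sup hR) le_sup_left (sup_le hlt.le (factorResidual_le hp N)) with e | e
  · refine (factorResidual_spec hp N).2.mono_left ?_
    rw [← e]; exact le_sup_right
  · exfalso
    obtain ⟨M, hKM, hM⟩ := exists_maximalNormalIn (hK.mono_right hlt.le hN.1) hlt
    by_cases hind : M.relIndex N = p
    · have hc := hM.normalIn.commutator_le hp hind
      have hcN : ⁅N, N⁆ ≤ N := hc.trans hM.normalIn.1
      rcases hmin _ (hK.sup hN.commutator) le_sup_left (sup_le hlt.le hcN) with e' | e'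
      · exact hnab (by rw [← e']; exact le_sup_right)
      · exact hM.ne (le_antisymm hM.normalIn.1 (by rw [← e']; exact sup_le hKM hc))
    · have hle := factorResidual_le_of hM.normalIn (hM.noFactor hp hind)
      exact hM.ne (le_antisymm hM.normalIn.1 (by rw [← e]; exact sup_le hKM hle))

/-- The residual of `H`, once normal in `A`, lies below the core, and no factor of order `p` occurs
from it up to the core, from the core to `N`, or from `N` to `A`. -/
theorem factorResidual_eq_of_nonabelian [Finite Γ] (hp : p.Prime) (hmax : MaximalIn H A)
    (hN : NormalIn N A) (hlt : coreIn A H < N)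
    (hmin : ∀ C, NormalIn C A → coreIn A H ≤ C → C ≤ N → C = coreIn A H ∨ C = N)
    (hnab : ¬ ⁅N, N⁆ ≤ coreIn A H) (hR : NormalIn (factorResidual p H) A) :
    factorResidual p A = factorResidual p H := by
  have hHA := hmax.lt.le
  have hK := coreIn_normalIn hHA
  have hRH := factorResidual_spec hp H
  have hRK : factorResidual p H ≤ coreIn A H := le_coreIn hR hRH.1.1
  have h1 : NoFactor p (factorResidual p H) (coreIn A H) :=
    hRH.2.of_subnormalIn (hK.mono_right coreIn_le hHA).subnormalIn
  have h2 : NoFactor p (factorResidual p H) N :=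
    NoFactor.trans hp h1 (noFactor_of_nonabelian_minimal hp hK hN hlt hmin hnab)
      (hK.mono_right hlt.le hN.1) hRK
  -- Since `A = HN`, a section of `A` above `N` has the same order as its intersection with `H`.
  have h3 : NoFactor p N A := by
    intro S T hT hS hTS hind
    have hSH : SubnormalIn (S ⊓ H) H := by
      have := hS.inf_right H
      rwa [inf_eq_right.2 hHA] at this
    refine hRH.2 (S ⊓ H) (T ⊓ H) (le_inf ((hRK.trans hlt.le).trans hT) hRH.1.1) hSH
      (hTS.inf_right H) ?_
    rw [← hind, Subgroup.relIndex_eq_of_forall_eq_mul (inf_le_left : S ⊓ H ≤ S)]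
    · rw [← Subgroup.inf_relIndex_right T (S ⊓ H), ← inf_assoc, inf_eq_left.2 hTS.1]
    · intro v hv
      obtain ⟨h, hh, u, hu, e⟩ := hmax.exists_eq_mul hN hlt (hS.le hv)
      refine ⟨h, ⟨?_, hh⟩, u, hT hu, e⟩
      rw [e] at hv
      exact (Subgroup.mul_mem_cancel_right S (hTS.1 (hT hu))).1 hv
  have h4 : NoFactor p (factorResidual p H) A :=
    NoFactor.trans hp h2 h3 hN (hRK.trans hlt.le)
  rw [factorResidual_eq_of_normalIn hp hR h4, factorResidual_factorResidual hp]

/-- Conjugation by `z` swaps `H` and `zHz⁻¹`, because `z² ∈ H`. -/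
theorem conj_mem_inf_conjSubgroup_iff {z : Γ} (hz : z ^ 2 ∈ H) (b : Γ) :
    b ∈ H ⊓ conjSubgroup z H ↔ z * b * z⁻¹ ∈ H ⊓ conjSubgroup z H := by
  have e : z⁻¹ * b * z = (z ^ 2)⁻¹ * (z * b * z⁻¹) * z ^ 2 := by
    simp [pow_two, mul_assoc]
  have e' : z⁻¹ * (z * b * z⁻¹) * z = b := by simp [mul_assoc]
  rw [Subgroup.mem_inf, Subgroup.mem_inf, mem_conjSubgroup, mem_conjSubgroup, e', e, and_comm,
    Subgroup.mul_mem_cancel_right H hz, Subgroup.mul_mem_cancel_left H (H.inv_mem hz)]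

/-- The normalizer of the residual contains `H`, and also `z`, which normalizes `H ∩ zHz⁻¹`;
maximality does the rest. -/
theorem normalIn_factorResidual_of_sq_mem [Finite Γ] (hp : p.Prime) (hmax : MaximalIn H A) {z : Γ}
    (hzA : z ∈ A) (hzH : z ∉ H) (hz : z ^ 2 ∈ H)
    (heq : factorResidual p H = factorResidual p (H ⊓ conjSubgroup z H)) :
    NormalIn (factorResidual p H) A := by
  have hB := conj_mem_inf_conjSubgroup_iff hz
  have hB' : ∀ b, b ∈ H ⊓ conjSubgroup z H ↔ z⁻¹ * b * z⁻¹⁻¹ ∈ H ⊓ conjSubgroup z H := by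
    intro b
    rw [hB (z⁻¹ * b * z⁻¹⁻¹)]
    simp [mul_assoc]
  let M : Subgroup Γ := A ⊓ Subgroup.normalizer (factorResidual p H : Set Γ)
  have hHM : H ≤ M := by
    refine fun h hh => ⟨hmax.lt.le hh, Subgroup.mem_normalizer_iff.2 fun b => ?_⟩
    exact conj_mem_iff_of_normalIn (factorResidual_spec hp H).1 hh b
  have hzM : z ∈ M := by
    refine ⟨hzA, Subgroup.mem_normalizer_iff.2 fun b => ?_⟩
    rw [heq]
    refine ⟨fun hb => conj_mem_factorResidual hB hb, fun hb => ?_⟩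
    simpa [mul_assoc] using conj_mem_factorResidual hB' hb
  have hMA : M = A := hmax.eq_of_mem hHM inf_le_left hzM hzH
  refine ⟨(factorResidual_le hp H).trans hmax.lt.le, fun a ha k hk => ?_⟩
  rw [← hMA] at ha
  exact (Subgroup.mem_normalizer_iff.1 ha.2 k).1 hk

end NonabelianSocle

/-! ### The main induction on the index -/

theorem ncard_residualPrimes_lt [Finite Γ] (n : ℕ) : ∀ A H : Subgroup Γ, H ≤ A →
    H.relIndex A = n → 2 ≤ n → ((residualPrimes A H).ncard : ℝ) < 2 * Real.logb 2 n ^ 2 := by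
  induction n using Nat.strong_induction_on with
  | _ n ih =>
  intro A H hHA hn hn2
  have hlt : H < A := by
    refine lt_of_le_of_ne hHA fun e => ?_
    rw [e, Subgroup.relIndex_self] at hn
    omega
  have hL := one_le_logb_two hn2
  rcases MaximalIn.or_exists_between hlt with hmax | ⟨M, hHM, hMA⟩
  · have hmono : ((residualPrimes A H).ncard : ℝ) ≤ (elementPrimes A H).ncard := by
      exact_mod_cast Set.ncard_le_ncard (residualPrimes_subset_elementPrimes hHA)
        (elementPrimes_finite A H)
    by_cases hsq : ∀ u ∈ A, u ^ 2 ∈ H → u ∈ H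
    · have := ncard_elementPrimes_le n A H hHA hn (two_notMem_elementPrimes hsq)
      nlinarith
    push Not at hsq
    obtain ⟨z, hzA, hz, hzH⟩ := hsq
    obtain ⟨N, hN, hNmin⟩ := Set.Finite.exists_minimal
      (Set.toFinite {N : Subgroup Γ | NormalIn N A ∧ coreIn A H < N})
      ⟨A, NormalIn.refl A, lt_of_le_of_lt coreIn_le hlt⟩
    have hmin : ∀ C, NormalIn C A → coreIn A H ≤ C → C ≤ N → C = coreIn A H ∨ C = N := by
      intro C hC hKC hCN
      rcases hKC.eq_or_lt with e | e
      · exact Or.inl e.symm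
      · exact Or.inr (le_antisymm hCN (hNmin ⟨hC, e⟩ hCN))
    by_cases hab : ⁅N, N⁆ ≤ coreIn A H
    · rw [Subgroup.commutator_le] at hab
      have := ncard_elementPrimes_lt_of_abelian hmax hN.1 hN.2 hab
      rw [hn] at this
      linarith
    · have hsub : residualPrimes A H ⊆ residualPrimes H (H ⊓ conjSubgroup z H) := by
        rintro p ⟨hp, hne⟩
        refine ⟨hp, fun heq => hne ?_⟩
        exact factorResidual_eq_of_nonabelian hp hmax hN.1 hN.2 hmin hab
          (normalIn_factorResidual_of_sq_mem hp hmax hzA hzH hz heq)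
      have hle : ((residualPrimes A H).ncard : ℝ) ≤
          (residualPrimes H (H ⊓ conjSubgroup z H)).ncard := by
        exact_mod_cast Set.ncard_le_ncard hsub (residualPrimes_finite inf_le_left)
      have hd := relIndex_inf_conjSubgroup_lt hHA hzA hzH
      have hd0 := Subgroup.relIndex_ne_zero_of_finite (H ⊓ conjSubgroup z H) H
      rw [hn] at hd
      -- The strict bound fails at index 1, so the induction hypothesis needs index at least 2; at
      -- index 1 there are no primes to count.
      rcases Nat.lt_or_ge ((H ⊓ conjSubgroup z H).relIndex H) 2 with h1 | h1
      · have h1' : (H ⊓ conjSubgroup z H).relIndex H = 1 := by omega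
        have e : H ⊓ conjSubgroup z H = H :=
          le_antisymm inf_le_left (Subgroup.relIndex_eq_one.1 h1')
        rw [e, residualPrimes_self, Set.ncard_empty, Nat.cast_zero] at hle
        nlinarith
      · have h2 := ih _ hd H (H ⊓ conjSubgroup z H) inf_le_left rfl h1
        have h3 : Real.logb 2 ((H ⊓ conjSubgroup z H).relIndex H) ≤ Real.logb 2 n :=
          Real.logb_le_logb_of_le one_lt_two (by positivity) (by exact_mod_cast hd.le)
        have h4 := one_le_logb_two h1
        nlinarith
  · have hmul := Subgroup.relIndex_mul_relIndex H M A hHM.le hMA.le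
    have h1 := Subgroup.one_lt_relIndex_of_lt hHM
    have h3 := Subgroup.one_lt_relIndex_of_lt hMA
    rw [hn] at hmul
    have i1 := ih (M.relIndex A) (by nlinarith) A M hMA.le rfl h3
    have i2 := ih (H.relIndex M) (by nlinarith) M H hHM.le rfl h1
    have hle : (residualPrimes A H).ncard ≤
        (residualPrimes A M).ncard + (residualPrimes M H).ncard :=
      (Set.ncard_le_ncard (residualPrimes_subset_union A M H)
        ((residualPrimes_finite hMA.le).union (residualPrimes_finite hHM.le))).trans
        (Set.ncard_union_le _ _)
    have hle' : ((residualPrimes A H).ncard : ℝ) ≤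
        (residualPrimes A M).ncard + (residualPrimes M H).ncard := by exact_mod_cast hle
    have := logb_sq_add_logb_sq_le h1.le h3.le
    rw [hmul] at this
    linarith

/-! ### From composition factors to residuals -/

theorem IsSimpleGroup.card_prime_of_commutes {Q : Type*} [Group Q] [Finite Q] [IsSimpleGroup Q]
    (h : ∀ a b : Q, a * b = b * a) : (Nat.card Q).Prime := by
  let _ : CommGroup Q := { ‹Group Q› with mul_comm := h }
  exact IsSimpleGroup.prime_card

theorem subnormalIn_top_of_compositionSeries {L : Type*} [Group L] (s : GroupCompositionSeries L)
    (i : Fin (s.series.length + 1)) : SubnormalIn (s.series i) ⊤ := by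
  induction i using Fin.reverseInduction with
  | last =>
    have : s.series (Fin.last _) = ⊤ := s.last_eq_top
    rw [this]
    exact SubnormalIn.refl _
  | cast i ih =>
    have hstep : IsCompositionStep (s.series i.castSucc) (s.series i.succ) := s.series.step i
    obtain ⟨hle, hn, _⟩ := hstep
    have : NormalIn (s.series i.castSucc) (s.series i.succ) :=
      ⟨hle, fun a ha k hk => by
        have := hn.conj_mem ⟨k, hle hk⟩ (by simpa [Subgroup.mem_subgroupOf] using hk) ⟨a, ha⟩
        simpa [Subgroup.mem_subgroupOf] using this⟩
    exact this.subnormalIn.trans ih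

theorem IsCompositionFactor.card_ne {H : Subgroup Γ} {Q : Type*} [Group Q] {p : ℕ}
    (h : IsCompositionFactor H Q) (hH : NoFactor p ⊥ H) : Nat.card Q ≠ p := by
  obtain ⟨s, i, hn, ⟨e⟩⟩ := h
  have hstep : IsCompositionStep (s.series i.castSucc) (s.series i.succ) := s.series.step i
  have hle := hstep.1
  have hmap : ∀ {K A : Subgroup H}, NormalIn K A →
      NormalIn (K.map H.subtype) (A.map H.subtype) := by
    intro K A hKA
    refine ⟨Subgroup.map_mono hKA.1, ?_⟩
    rintro _ ⟨a, ha, rfl⟩ _ ⟨k, hk, rfl⟩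
    exact ⟨a * k * a⁻¹, hKA.2 a ha k hk, by simp⟩
  have hT : NormalIn (s.series i.castSucc) (s.series i.succ) :=
    ⟨hle, fun a ha k hk => by
      have := hn.conj_mem ⟨k, hle hk⟩ (by simpa [Subgroup.mem_subgroupOf] using hk) ⟨a, ha⟩
      simpa [Subgroup.mem_subgroupOf] using this⟩
  have hS : SubnormalIn ((s.series i.succ).map H.subtype) H := by
    have h1 := Relation.ReflTransGen.lift (fun K : Subgroup H => K.map H.subtype)
      (fun _ _ => hmap) _ _ (subnormalIn_top_of_compositionSeries s i.succ)
    have h2 : (⊤ : Subgroup H).map H.subtype = H := by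
      rw [← MonoidHom.range_eq_map, Subgroup.range_subtype]
    have h3 : SubnormalIn ((s.series i.succ).map H.subtype) ((⊤ : Subgroup H).map H.subtype) := h1
    rwa [h2] at h3
  have := hH _ _ bot_le hS (hmap hT)
  rw [Subgroup.relIndex_map_map_of_injective _ _ H.subtype_injective] at this
  rw [Nat.card_congr e.toEquiv]
  exact this

theorem IsCompositionFactor.isSimpleGroup {L Q : Type*} [Group L] [Group Q]
    (h : IsCompositionFactor L Q) : IsSimpleGroup Q := by
  obtain ⟨s, i, hn, ⟨e⟩⟩ := h
  have hstep : IsCompositionStep (s.series i.castSucc) (s.series i.succ) := s.series.step i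
  obtain ⟨_, _, hs⟩ := hstep
  exact e.isSimpleGroup

theorem IsCompositionFactor.finite {L Q : Type*} [Group L] [Finite L] [Group Q]
    (h : IsCompositionFactor L Q) : Finite Q := by
  obtain ⟨s, i, hn, ⟨e⟩⟩ := h
  exact Finite.of_equiv _ e.symm.toEquiv

/-- The isomorphism type of the cyclic group of order `p`. -/
def cyclicIsoType.{u} (p : ℕ) : GroupIsoType.{u} :=
  Quotient.mk _ (GrpCat.of (ULift.{u} (Multiplicative (ZMod p))))

theorem eq_cyclicIsoType.{u} (Q : GrpCat.{u}) {p : ℕ} (hp : p.Prime) (hQ : Nat.card Q = p) :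
    (Quotient.mk _ Q : GroupIsoType.{u}) = cyclicIsoType p := by
  have : Fact p.Prime := ⟨hp⟩
  have hZ : Nat.card (ULift.{u} (Multiplicative (ZMod p))) = p := by
    rw [Nat.card_congr Equiv.ulift, Nat.card_congr Multiplicative.toAdd, Nat.card_zmod]
  exact Quotient.sound ⟨(mulEquivOfPrimeCardEq hQ hZ).toGrpIso⟩

/-- Equal residuals would give a normal subgroup of the whole group inside `H`, hence `⊥`, and then
`H` has no composition factor of that order. -/
theorem compA_subset_image.{u} {Γ : Type u} [Group Γ] [Finite Γ] (H : Subgroup Γ)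
    (hcore : ∀ C : Subgroup Γ, C ≤ H → C.Normal → C = ⊥) :
    CompA H ⊆ cyclicIsoType '' residualPrimes ⊤ H := by
  rintro c ⟨Q, rfl, hQ, hcomm⟩
  have := hQ.finite
  have := hQ.isSimpleGroup
  have hp := IsSimpleGroup.card_prime_of_commutes hcomm
  refine ⟨Nat.card Q, ⟨hp, fun heq => ?_⟩, (eq_cyclicIsoType Q hp rfl).symm⟩
  have hbot : factorResidual (Nat.card Q) H = ⊥ := by
    refine hcore _ (factorResidual_le hp H) ⟨fun n hn g => ?_⟩
    rw [← heq] at hn ⊢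
    exact (factorResidual_spec hp ⊤).1.2 g trivial n hn
  have hno := (factorResidual_spec hp H).2
  rw [hbot] at hno
  exact hQ.card_ne hno rfl

end

theorem theorem7 {Ω : Type*} [Finite Ω] (n : ℕ) (hn : Nat.card Ω = n) (hn2 : 2 ≤ n)
    (G : Subgroup (Equiv.Perm Ω)) (hG : MulAction.IsPretransitive G Ω) (x : Ω) :
    (CompA (MulAction.stabilizer G x)).Finite ∧
      ((CompA (MulAction.stabilizer G x)).ncard : ℝ) < 2 * (Real.logb 2 n) ^ 2 := by
  -- A normal subgroup fixing `x` fixes every `g • x`, hence by transitivity every point.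
  have hcore : ∀ C : Subgroup G, C ≤ MulAction.stabilizer G x → C.Normal → C = ⊥ := by
    intro C hC hCn
    rw [eq_bot_iff]
    intro c hc
    rw [Subgroup.mem_bot]
    apply Subtype.ext
    ext y
    obtain ⟨g, rfl⟩ := MulAction.exists_smul_eq G x y
    have h1 : (g⁻¹ * c * g⁻¹⁻¹) • x = x := hC (hCn.conj_mem c hc g⁻¹)
    rw [inv_inv, mul_smul, mul_smul, inv_smul_eq_iff] at h1
    exact h1
  have hsub := compA_subset_image _ hcore
  have hfin : (residualPrimes ⊤ (MulAction.stabilizer G x)).Finite :=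
    residualPrimes_finite le_top
  have hind : (MulAction.stabilizer G x).relIndex ⊤ = n := by
    rw [Subgroup.relIndex_top_right, MulAction.index_stabilizer_of_transitive, hn]
  refine ⟨(hfin.image _).subset hsub, lt_of_le_of_lt ?_
    (ncard_residualPrimes_lt n _ _ le_top hind hn2)⟩
  exact_mod_cast (Set.ncard_le_ncard hsub (hfin.image _)).trans (Set.ncard_image_le hfin)
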